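/- Let $H$ be a real separable Hilbert space, let $\mathcal P_2(H)$ be the space of Borel probability measures on $H$ with finite second moment $m_2^2(\mu)=\int_H|x|^2\,d\mu(x)$, with the Wasserstein distance $W_2$ of order two, and let $\Gamma_o(\mu,\nu)$ be the set of optimal transport plans for the cost $|x-y|^2$ between $\mu$ and $\nu$. Let $\alpha>0$, $\nu_0\in\mathcal P_2(H)$, and let $\sigma$ be a positive measure on the Borel $\sigma$-algebra of $(\mathcal P_2(H),W_2)$ with $\sigma(\mathcal P_2(H))=\alpha$ and $\int_{\mathcal P_2(H)} m_2^2(\nu)\,d\sigma(\nu)<\infty$. Then $\nu\mapsto W_2^2(\mu,\nu)$ is $\sigma$-integrable for every $\mu\in\mathcal P_2(H)$, and the functional $$\mathscr E:\mathcal P_2(H)\to\mathbb R,\qquad \mathscr E(\mu)=(1+\alpha)\,W_2^2(\mu,\nu_0)-\int_{\mathcal P_2(H)}W_2^2(\mu,\nu)\,d\sigma(\nu),$$ is $1$-convex along generalized geodesics with basepoint $\nu_0$. That is, let $\gamma_0,\gamma_1\in\mathcal P_2(H)$, let $\boldsymbol\gamma$ be any Borel probability measure on $H\times H\times H$ (with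 coordinate projections $\pi^0,\pi^1,\pi^2$) such that $(\pi^0,\pi^2)_\#\boldsymbol\gamma\in\Gamma_o(\gamma_0,\nu_0)$ and $(\pi^1,\pi^2)_\#\boldsymbol\gamma\in\Gamma_o(\gamma_1,\nu_0)$, and put $\gamma_t=\big((1-t)\pi^0+t\pi^1\big)_\#\boldsymbol\gamma$ for $t\in[0,1]$. Then for every $t\in[0,1]$ $$\mathscr E(\gamma_t)\le(1-t)\,\mathscr E(\gamma_0)+t\,\mathscr E(\gamma_1)-t(1-t)\,W_2^2(\gamma_0,\gamma_1).$$ -/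

import Mathlib

open MeasureTheory
open scoped ENNReal

noncomputable section

namespace SignedBarycenter

section Wasserstein

variable (H : Type*) [NormedAddCommGroup H] [MeasurableSpace H]

/-- The space `𝒫₂(H)` of Borel probability measures on `H` with finite second moment. -/
structure P2 where
  /-- The underlying measure on `H`. -/
  toMeasure : Measure H
  isProbabilityMeasure : IsProbabilityMeasure toMeasure
  moment_lt_top : ∫⁻ x, ‖x‖ₑ ^ 2 ∂toMeasure < ∞

variable {H}

/-- The second moment `m₂²(μ) = ∫ |x|² dμ(x)`, as an extended nonnegative number. -/
def secondMoment (μ : P2 H) : ℝ≥0∞ := ∫⁻ x, ‖x‖ₑ ^ 2 ∂μ.toMeasure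

/-- The set `Γ(μ, ν)` of transport plans between `μ` and `ν`. -/
def plans (μ ν : P2 H) : Set (Measure (H × H)) :=
  {π | IsProbabilityMeasure π ∧ π.map Prod.fst = μ.toMeasure ∧ π.map Prod.snd = ν.toMeasure}

/-- The quadratic transport cost `∫ |x - y|² dπ(x, y)`. -/
def cost (π : Measure (H × H)) : ℝ≥0∞ := ∫⁻ p, ‖p.1 - p.2‖ₑ ^ 2 ∂π

/-- The squared distance `W₂²(μ, ν)` as an extended nonnegative number; it is finite on `𝒫₂(H)`. -/
def eW2sq (μ ν : P2 H) : ℝ≥0∞ := ⨅ π ∈ plans μ ν, cost π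

/-- The Wasserstein distance `W₂` of order two on `𝒫₂(H)`. -/
def W2 (μ ν : P2 H) : ℝ := √(eW2sq μ ν).toReal

/-- The set `Γₒ(μ, ν)` of optimal transport plans between `μ` and `ν`. -/
def optimalPlans (μ ν : P2 H) : Set (Measure (H × H)) :=
  {π | π ∈ plans μ ν ∧ cost π = eW2sq μ ν}

/-- The metric topology of `W₂` on `𝒫₂(H)`: a set is open if it contains a `W₂`-ball around each
of its points. -/
instance : TopologicalSpace (P2 H) where
  IsOpen U := ∀ μ ∈ U, ∃ ε : ℝ, 0 < ε ∧ ∀ ν, W2 μ ν < ε → ν ∈ U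
  isOpen_univ := fun _ _ => ⟨1, one_pos, fun _ _ => trivial⟩
  isOpen_inter := by
    rintro U V hU hV μ ⟨hμU, hμV⟩
    obtain ⟨ε, hε, h1⟩ := hU μ hμU
    obtain ⟨δ, hδ, h2⟩ := hV μ hμV
    exact ⟨min ε δ, lt_min hε hδ, fun ν hν =>
      ⟨h1 ν (hν.trans_le (min_le_left _ _)), h2 ν (hν.trans_le (min_le_right _ _))⟩⟩
  isOpen_sUnion := by
    rintro S hS μ ⟨U, hU, hμ⟩
    obtain ⟨ε, hε, h⟩ := hS U hU μ hμ
    exact ⟨ε, hε, fun ν hν => ⟨U, hU, h ν hν⟩⟩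

/-- The Borel σ-algebra of the metric space `(𝒫₂(H), W₂)`. -/
instance : MeasurableSpace (P2 H) := borel (P2 H)

instance : BorelSpace (P2 H) := ⟨rfl⟩

/-- The functional `E(μ) = (1 + α) W₂²(μ, ν₀) - ∫ W₂²(μ, ν) dσ(ν)`. -/
def energy (α : ℝ) (ν₀ : P2 H) (σ : Measure (P2 H)) (μ : P2 H) : ℝ :=
  (1 + α) * W2 μ ν₀ ^ 2 - ∫ ν, W2 μ ν ^ 2 ∂σ

/-- `γ` is a generalized geodesic with basepoint `ν₀`, connecting `γ 0` to `γ 1`: there is a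
probability measure `Γ` on `H × H × H` whose `(0,2)` and `(1,2)` marginals are optimal plans from
`γ 0`, respectively `γ 1`, to `ν₀`, such that `γ t` is the push-forward of `Γ` under
`(1 - t) π⁰ + t π¹`. -/
def IsGeneralizedGeodesic [NormedSpace ℝ H] (ν₀ : P2 H) (γ : unitInterval → P2 H) : Prop :=
  ∃ Γ : Measure (H × H × H), IsProbabilityMeasure Γ ∧
    Γ.map (fun p => (p.1, p.2.2)) ∈ optimalPlans (γ 0) ν₀ ∧
    Γ.map (fun p => (p.2.1, p.2.2)) ∈ optimalPlans (γ 1) ν₀ ∧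
    ∀ t : unitInterval,
      (γ t).toMeasure = Γ.map (fun p => (1 - (t : ℝ)) • p.1 + (t : ℝ) • p.2.1)

end Wasserstein

/-- `F` is `κ`-convex, with respect to the distance `d`, along all curves of the class `𝒢`. -/
def IsConvexAlong {M : Type*} (d : M → M → ℝ) (𝒢 : Set (unitInterval → M)) (κ : ℝ)
    (F : M → ℝ) : Prop :=
  ∀ γ ∈ 𝒢, ∀ s : unitInterval,
    F (γ s) ≤ (1 - (s : ℝ)) * F (γ 0) + (s : ℝ) * F (γ 1)
      - κ * (s : ℝ) * (1 - (s : ℝ)) * d (γ 0) (γ 1) ^ 2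

end SignedBarycenter

end

open ProbabilityTheory

namespace SignedBarycenter

/-! Everything rests on the Hilbert identity |sx + ty - z|² + st|x - y|² = s|x - z|² + t|y - z|² for
s + t = 1, integrated twice. Let A = ∫ |x - y|² dΓ. With z the basepoint coordinate of Γ, optimality
of the two marginal plans makes the right side a combination of W₂² values, so W₂²(·, ν₀) gains at
least stA over linear interpolation. For any other ν, gluing a plan from γ_t to ν onto Γ reverses
the inequality: W₂²(·, ν) gains at most stA, with the same A. Weight 1 + α on the first and total
mass α on the second leave one copy of stA, and A ≥ W₂²(γ₀, γ₁) because Γ couples the endpoints. -/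

/-- Gluing: a coupling `π` whose first marginal is the law of `f` under `Γ` can be realised on an
extension of `Γ` by one further coordinate. -/
theorem exists_gluing {X Y Z : Type*} [MeasurableSpace X] [MeasurableSpace Y] [MeasurableSpace Z]
    [StandardBorelSpace Z] [Nonempty Z] (Γ : Measure X) [IsProbabilityMeasure Γ] {f : X → Y}
    (hf : Measurable f) (π : Measure (Y × Z)) [IsProbabilityMeasure π]
    (h : π.map Prod.fst = Γ.map f) :
    ∃ Θ : Measure (X × Z), IsProbabilityMeasure Θ ∧ Θ.map Prod.fst = Γ ∧
      Θ.map (fun p => (f p.1, p.2)) = π := by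
  -- Disintegrate `π` over its first coordinate and pull the kernel back along `f`.
  refine ⟨Γ ⊗ₘ (π.condKernel.comap f hf), inferInstance, Measure.fst_compProd _ _, ?_⟩
  have hm : Measurable (fun p : X × Z => (f p.1, p.2)) :=
    (hf.comp measurable_fst).prodMk measurable_snd
  conv_rhs => rw [← π.disintegrate π.condKernel]
  ext s hs
  have hfst : π.fst = Γ.map f := h
  rw [Measure.map_apply hm hs, Measure.compProd_apply (hm hs), Measure.compProd_apply hs, hfst,
    lintegral_map (Kernel.measurable_kernel_prodMk_left hs) hf]
  rfl

theorem enorm_sq_add_le {E : Type*} [SeminormedAddCommGroup E] (x y : E) :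
    ‖x + y‖ₑ ^ 2 ≤ 2 * ‖x‖ₑ ^ 2 + 2 * ‖y‖ₑ ^ 2 := by
  have h : ‖x + y‖₊ ^ 2 ≤ 2 * ‖x‖₊ ^ 2 + 2 * ‖y‖₊ ^ 2 := by
    rw [← NNReal.coe_le_coe]
    push_cast
    nlinarith [norm_add_le x y, norm_nonneg (x + y), sq_nonneg (‖x‖ - ‖y‖)]
  simp only [enorm_eq_nnnorm]
  exact_mod_cast h

theorem enorm_sq_sub_le {E : Type*} [SeminormedAddCommGroup E] (x y : E) :
    ‖x - y‖ₑ ^ 2 ≤ 2 * ‖x‖ₑ ^ 2 + 2 * ‖y‖ₑ ^ 2 := by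
  simpa [sub_eq_add_neg] using enorm_sq_add_le x (-y)

/-- Written without subtraction, so that it integrates in `ℝ≥0∞` with no integrability conditions.
-/
theorem enorm_sq_segment {H : Type*} [NormedAddCommGroup H] [InnerProductSpace ℝ H]
    (s t : NNReal) (hst : s + t = 1) (x y z : H) :
    ‖(s : ℝ) • x + (t : ℝ) • y - z‖ₑ ^ 2 + ((s * t : NNReal) : ℝ≥0∞) * ‖x - y‖ₑ ^ 2 =
      s * ‖x - z‖ₑ ^ 2 + t * ‖y - z‖ₑ ^ 2 := by
  have h : ‖(s : ℝ) • x + (t : ℝ) • y - z‖₊ ^ 2 + s * t * ‖x - y‖₊ ^ 2 =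
      s * ‖x - z‖₊ ^ 2 + t * ‖y - z‖₊ ^ 2 := by
    rw [← NNReal.coe_inj]
    push_cast
    have hst' : (s : ℝ) = 1 - t := by
      have : (s : ℝ) + t = 1 := by exact_mod_cast hst
      linarith
    have h1 : (s : ℝ) • x + (t : ℝ) • y - z = (s : ℝ) • (x - z) + (t : ℝ) • (y - z) := by
      rw [hst']; module
    have h2 : x - y = (x - z) - (y - z) := by abel
    rw [h1, h2, norm_add_sq_real, norm_sub_sq_real, norm_smul, norm_smul, inner_smul_left,
      inner_smul_right, hst']
    simp only [Real.norm_eq_abs, mul_pow, sq_abs, conj_trivial]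
    ring
  simp only [enorm_eq_nnnorm]
  exact_mod_cast h

section

variable {H : Type*} [NormedAddCommGroup H] [MeasurableSpace H]

theorem eW2sq_le_lintegral [BorelSpace H] [SecondCountableTopology H] {X : Type*}
    [MeasurableSpace X] {μ ν : P2 H} (Θ : Measure X) [IsProbabilityMeasure Θ]
    {f g : X → H} (hf : Measurable f) (hg : Measurable g) (hμ : Θ.map f = μ.toMeasure)
    (hν : Θ.map g = ν.toMeasure) : eW2sq μ ν ≤ ∫⁻ x, ‖f x - g x‖ₑ ^ 2 ∂Θ := by
  have hfg : Measurable fun x => (f x, g x) := hf.prodMk hg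
  have hmem : Θ.map (fun x => (f x, g x)) ∈ plans μ ν := by
    refine ⟨Measure.isProbabilityMeasure_map hfg.aemeasurable, ?_, ?_⟩
    · rw [Measure.map_map measurable_fst hfg]; exact hμ
    · rw [Measure.map_map measurable_snd hfg]; exact hν
  refine (iInf₂_le _ hmem).trans_eq ?_
  rw [cost, lintegral_map (by fun_prop) hfg]

theorem eW2sq_le_secondMoment [BorelSpace H] [SecondCountableTopology H] (μ ν : P2 H) :
    eW2sq μ ν ≤ 2 * secondMoment μ + 2 * secondMoment ν := by
  have := μ.isProbabilityMeasure
  have := ν.isProbabilityMeasure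
  refine (eW2sq_le_lintegral (μ.toMeasure.prod ν.toMeasure) measurable_fst measurable_snd
    (by simp) (by simp)).trans ?_
  refine (lintegral_mono (g := fun p : H × H => 2 * ‖p.1‖ₑ ^ 2 + 2 * ‖p.2‖ₑ ^ 2)
    fun p => enorm_sq_sub_le p.1 p.2).trans_eq ?_
  have h1 : ∫⁻ p : H × H, ‖p.1‖ₑ ^ 2 ∂(μ.toMeasure.prod ν.toMeasure) = secondMoment μ := by
    rw [← lintegral_map (f := fun x : H => ‖x‖ₑ ^ 2) (by fun_prop) measurable_fst]
    simp [secondMoment]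
  have h2 : ∫⁻ p : H × H, ‖p.2‖ₑ ^ 2 ∂(μ.toMeasure.prod ν.toMeasure) = secondMoment ν := by
    rw [← lintegral_map (f := fun x : H => ‖x‖ₑ ^ 2) (by fun_prop) measurable_snd]
    simp [secondMoment]
  rw [lintegral_add_left (by fun_prop), lintegral_const_mul _ (by fun_prop),
    lintegral_const_mul _ (by fun_prop), h1, h2]

theorem secondMoment_lt_top (μ : P2 H) : secondMoment μ < ∞ := μ.moment_lt_top

theorem eW2sq_lt_top [BorelSpace H] [SecondCountableTopology H] (μ ν : P2 H) : eW2sq μ ν < ∞ :=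
  (eW2sq_le_secondMoment μ ν).trans_lt (ENNReal.add_lt_top.2
    ⟨ENNReal.mul_lt_top (by simp) (secondMoment_lt_top μ),
      ENNReal.mul_lt_top (by simp) (secondMoment_lt_top ν)⟩)

theorem W2_sq (μ ν : P2 H) : W2 μ ν ^ 2 = (eW2sq μ ν).toReal :=
  Real.sq_sqrt ENNReal.toReal_nonneg

theorem W2_lt_iff [BorelSpace H] [SecondCountableTopology H] {μ ν : P2 H} {r : ℝ} (hr : 0 < r) :
    W2 μ ν < r ↔ ∃ π ∈ plans μ ν, cost π < ENNReal.ofReal (r ^ 2) := by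
  rw [W2, Real.sqrt_lt' hr, ← ENNReal.lt_ofReal_iff_toReal_lt (eW2sq_lt_top μ ν).ne, eW2sq]
  simp [iInf_lt_iff]

/-- Minkowski in L² on two glued plans. The strict form of the triangle inequality needs only
near-optimal plans; it serves to make `W2 μ` measurable. -/
theorem W2_lt_add [BorelSpace H] [SecondCountableTopology H] [CompleteSpace H] {μ ν ρ : P2 H}
    {r s : ℝ} (hμν : W2 μ ν < r) (hνρ : W2 ν ρ < s) : W2 μ ρ < r + s := by
  have hr : 0 < r := (Real.sqrt_nonneg _).trans_lt hμν
  have hs : 0 < s := (Real.sqrt_nonneg _).trans_lt hνρ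
  obtain ⟨π, ⟨hπ, hπ1, hπ2⟩, hπr⟩ := (W2_lt_iff hr).1 hμν
  obtain ⟨η, ⟨hη, hη1, hη2⟩, hηs⟩ := (W2_lt_iff hs).1 hνρ
  obtain ⟨Θ, hΘ, hΘ1, hΘ2⟩ := exists_gluing π measurable_snd η (hη1.trans hπ2.symm)
  have hm : Measurable (fun p : (H × H) × H => (p.1.2, p.2)) := by fun_prop
  have hle : eW2sq μ ρ ≤ ∫⁻ p, ‖p.1.1 - p.2‖ₑ ^ 2 ∂Θ := by
    refine eW2sq_le_lintegral Θ (by fun_prop) measurable_snd ?_ ?_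
    · rw [← hπ1, ← hΘ1, Measure.map_map measurable_fst measurable_fst]; rfl
    · rw [← hη2, ← hΘ2, Measure.map_map measurable_snd hm]; rfl
  have h1 : ∫⁻ p, ‖p.1.1 - p.1.2‖ₑ ^ 2 ∂Θ = cost π := by
    rw [cost, ← hΘ1, lintegral_map (by fun_prop) measurable_fst]
  have h2 : ∫⁻ p, ‖p.1.2 - p.2‖ₑ ^ 2 ∂Θ = cost η := by
    rw [cost, ← hΘ2, lintegral_map (by fun_prop) hm]
  have hroot : ∀ {c : ℝ≥0∞} {a : ℝ}, 0 < a → c < ENNReal.ofReal (a ^ 2) →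
      c ^ (1 / (2 : ℝ)) < ENNReal.ofReal a := by
    intro c a ha h
    rw [one_div, ENNReal.rpow_inv_lt_iff two_pos, ENNReal.ofReal_rpow_of_pos ha]
    simpa using h
  have hmink : (∫⁻ p, ‖p.1.1 - p.2‖ₑ ^ 2 ∂Θ) ^ (1 / (2 : ℝ)) ≤
      cost π ^ (1 / (2 : ℝ)) + cost η ^ (1 / (2 : ℝ)) := by
    rw [← h1, ← h2]
    have h := ENNReal.lintegral_Lp_add_le (μ := Θ) (p := 2)
      (f := fun p => ‖p.1.1 - p.1.2‖ₑ) (g := fun p => ‖p.1.2 - p.2‖ₑ)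
      (by fun_prop) (by fun_prop) one_le_two
    simp only [ENNReal.rpow_two, Pi.add_apply] at h
    refine le_trans ?_ h
    gcongr with p
    simpa using enorm_add_le (p.1.1 - p.1.2) (p.1.2 - p.2)
  rw [W2, Real.sqrt_lt' (add_pos hr hs), ← ENNReal.lt_ofReal_iff_toReal_lt (eW2sq_lt_top μ ρ).ne]
  refine hle.trans_lt ?_
  have h := hmink.trans_lt (ENNReal.add_lt_add (hroot hr hπr) (hroot hs hηs))
  rw [← ENNReal.ofReal_add hr.le hs.le, one_div, ENNReal.rpow_inv_lt_iff two_pos,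
    ENNReal.ofReal_rpow_of_pos (add_pos hr hs)] at h
  simpa using h

theorem measurable_W2 [BorelSpace H] [SecondCountableTopology H] [CompleteSpace H] (μ : P2 H) :
    Measurable (W2 μ) := by
  refine measurable_of_Iio fun a => IsOpen.measurableSet ?_
  intro ν hν
  obtain ⟨r, hνr, hra⟩ := exists_between (show W2 μ ν < a from hν)
  refine ⟨a - r, sub_pos.2 hra, fun ρ hρ => ?_⟩
  simpa using W2_lt_add hνr hρ

theorem integrable_W2_sq [BorelSpace H] [SecondCountableTopology H] [CompleteSpace H]
    (σ : Measure (P2 H)) [IsFiniteMeasure σ] (hσ : ∫⁻ ν, secondMoment ν ∂σ < ∞) (μ : P2 H) :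
    Integrable (fun ν => W2 μ ν ^ 2) σ := by
  refine ⟨((measurable_W2 μ).pow_const 2).aestronglyMeasurable, ?_⟩
  have h : ∀ ν, ‖W2 μ ν ^ 2‖ₑ ≤ 2 * secondMoment μ + 2 * secondMoment ν := fun ν => by
    rw [W2_sq, Real.enorm_of_nonneg ENNReal.toReal_nonneg,
      ENNReal.ofReal_toReal (eW2sq_lt_top μ ν).ne]
    exact eW2sq_le_secondMoment μ ν
  refine (lintegral_mono h).trans_lt ?_
  -- The primed lemma asks for a finite constant instead of measurability of `secondMoment`.
  rw [lintegral_add_left measurable_const, lintegral_const, lintegral_const_mul' _ _ (by simp)]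
  exact ENNReal.add_lt_top.2 ⟨ENNReal.mul_lt_top
    (ENNReal.mul_lt_top (by simp) (secondMoment_lt_top μ)) (measure_lt_top σ _),
    ENNReal.mul_lt_top (by simp) hσ⟩

end

section

variable {H : Type*} [NormedAddCommGroup H] [InnerProductSpace ℝ H] [MeasurableSpace H]
  [BorelSpace H] [SecondCountableTopology H]

theorem lintegral_enorm_sq_segment {X : Type*} [MeasurableSpace X] (Θ : Measure X) {f g h : X → H}
    (hf : Measurable f) (hg : Measurable g) (hh : Measurable h) (s t : NNReal) (hst : s + t = 1) :
    ∫⁻ x, ‖(s : ℝ) • f x + (t : ℝ) • g x - h x‖ₑ ^ 2 ∂Θ +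
        ((s * t : NNReal) : ℝ≥0∞) * ∫⁻ x, ‖f x - g x‖ₑ ^ 2 ∂Θ =
      s * ∫⁻ x, ‖f x - h x‖ₑ ^ 2 ∂Θ + t * ∫⁻ x, ‖g x - h x‖ₑ ^ 2 ∂Θ := by
  rw [← lintegral_const_mul _ (by fun_prop), ← lintegral_const_mul _ (by fun_prop),
    ← lintegral_const_mul _ (by fun_prop), ← lintegral_add_left (by fun_prop),
    ← lintegral_add_left (by fun_prop)]
  exact lintegral_congr fun x => enorm_sq_segment s t hst _ _ _

/-- Semiconcavity of `W₂²(·, ν)` along the interpolation induced by an arbitrary coupling. -/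
theorem le_eW2sq_segment [CompleteSpace H] {X : Type*} [MeasurableSpace X] (Γ : Measure X)
    [IsProbabilityMeasure Γ] {f g : X → H} (hf : Measurable f) (hg : Measurable g)
    {μ₀ μ₁ μ : P2 H} (h₀ : Γ.map f = μ₀.toMeasure) (h₁ : Γ.map g = μ₁.toMeasure)
    (s t : NNReal) (hst : s + t = 1)
    (hμ : Γ.map (fun x => (s : ℝ) • f x + (t : ℝ) • g x) = μ.toMeasure) (ν : P2 H) :
    s * eW2sq μ₀ ν + t * eW2sq μ₁ ν ≤
      eW2sq μ ν + ((s * t : NNReal) : ℝ≥0∞) * ∫⁻ x, ‖f x - g x‖ₑ ^ 2 ∂Γ := by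
  have hc : Measurable fun x => (s : ℝ) • f x + (t : ℝ) • g x := by fun_prop
  -- Truncated subtraction isolates the infimum over plans, even if the coupling cost is infinite.
  rw [← tsub_le_iff_right]
  refine le_iInf₂ fun π ⟨hπ, hπ1, hπ2⟩ => tsub_le_iff_right.2 ?_
  obtain ⟨Θ, hΘ, hΘ1, hΘ2⟩ := exists_gluing Γ hc π (hπ1.trans hμ.symm)
  have hm : Measurable fun p : X × H => ((s : ℝ) • f p.1 + (t : ℝ) • g p.1, p.2) := by fun_prop
  have hν : Θ.map Prod.snd = ν.toMeasure := by
    rw [← hπ2, ← hΘ2, Measure.map_map measurable_snd hm]; rfl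
  have hA : ∫⁻ p, ‖f p.1 - g p.1‖ₑ ^ 2 ∂Θ = ∫⁻ x, ‖f x - g x‖ₑ ^ 2 ∂Γ := by
    conv_rhs => rw [← hΘ1]
    rw [lintegral_map (by fun_prop) measurable_fst]
  have hC : ∫⁻ p, ‖(s : ℝ) • f p.1 + (t : ℝ) • g p.1 - p.2‖ₑ ^ 2 ∂Θ = cost π := by
    rw [cost, ← hΘ2, lintegral_map (by fun_prop) hm]
  have hseg := lintegral_enorm_sq_segment Θ (hf.comp measurable_fst) (hg.comp measurable_fst)
    measurable_snd s t hst
  simp only [Function.comp_apply] at hseg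
  rw [← hC, ← hA, hseg]
  gcongr
  · refine eW2sq_le_lintegral Θ (hf.comp measurable_fst) measurable_snd ?_ hν
    rw [← h₀, ← hΘ1, Measure.map_map hf measurable_fst]; rfl
  · refine eW2sq_le_lintegral Θ (hg.comp measurable_fst) measurable_snd ?_ hν
    rw [← h₁, ← hΘ1, Measure.map_map hg measurable_fst]; rfl

theorem isConvexAlong_energy [CompleteSpace H] {α : ℝ} (hα : 0 ≤ α) (ν₀ : P2 H)
    (σ : Measure (P2 H)) (hσ : σ Set.univ = ENNReal.ofReal α)
    (hint : ∀ μ : P2 H, Integrable (fun ν => W2 μ ν ^ 2) σ) :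
    IsConvexAlong W2 {γ | IsGeneralizedGeodesic ν₀ γ} 1 (energy α ν₀ σ) := by
  rintro γ ⟨Γ, hΓ, ⟨⟨-, hx, hz⟩, h02⟩, ⟨⟨-, hy, -⟩, h12⟩, hγ⟩ t
  have hσf : IsFiniteMeasure σ := ⟨by rw [hσ]; exact ENNReal.ofReal_lt_top⟩
  have m02 : Measurable fun p : H × H × H => (p.1, p.2.2) := by fun_prop
  have m12 : Measurable fun p : H × H × H => (p.2.1, p.2.2) := by fun_prop
  have mx : Measurable fun p : H × H × H => p.1 := by fun_prop
  have my : Measurable fun p : H × H × H => p.2.1 := by fun_prop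
  have mz : Measurable fun p : H × H × H => p.2.2 := by fun_prop
  rw [Measure.map_map measurable_fst m02] at hx
  rw [Measure.map_map measurable_snd m02] at hz
  rw [Measure.map_map measurable_fst m12] at hy
  rw [cost, lintegral_map (by fun_prop) m02] at h02
  rw [cost, lintegral_map (by fun_prop) m12] at h12
  set A := ∫⁻ p, ‖p.1 - p.2.1‖ₑ ^ 2 ∂Γ
  -- Compare both points with the basepoint coordinate; finiteness permits the passage to real
  -- numbers.
  have hAfin : A < ∞ := by
    have hle : A ≤ ∫⁻ p, 2 * ‖p.1 - p.2.2‖ₑ ^ 2 + 2 * ‖p.2.1 - p.2.2‖ₑ ^ 2 ∂Γ :=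
      lintegral_mono fun p => by simpa using enorm_sq_sub_le (p.1 - p.2.2) (p.2.1 - p.2.2)
    rw [lintegral_add_left (by fun_prop), lintegral_const_mul _ (by fun_prop),
      lintegral_const_mul _ (by fun_prop), h02, h12] at hle
    exact hle.trans_lt (ENNReal.add_lt_top.2 ⟨ENNReal.mul_lt_top (by simp) (eW2sq_lt_top _ _),
      ENNReal.mul_lt_top (by simp) (eW2sq_lt_top _ _)⟩)
  set a : NNReal := ⟨1 - t, sub_nonneg.2 t.2.2⟩
  set b : NNReal := ⟨t, t.2.1⟩
  have hab : a + b = 1 := by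
    exact NNReal.coe_injective (sub_add_cancel (1 : ℝ) t)
  have hac : (a : ℝ) = 1 - t := rfl
  have hbc : (b : ℝ) = t := rfl
  have hγt := (hγ t).symm
  rw [← hac, ← hbc] at hγt ⊢
  have hbase : eW2sq (γ t) ν₀ + ((a * b : NNReal) : ℝ≥0∞) * A ≤
      a * eW2sq (γ 0) ν₀ + b * eW2sq (γ 1) ν₀ := by
    rw [← h02, ← h12, ← lintegral_enorm_sq_segment Γ mx my mz a b hab]
    gcongr
    exact eW2sq_le_lintegral Γ (by fun_prop) mz hγt hz
  have hfour := le_eW2sq_segment Γ mx my hx hy a b hab hγt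
  have hend : eW2sq (γ 0) (γ 1) ≤ A := eW2sq_le_lintegral Γ mx my hx hy
  have fin : ∀ μ ν : P2 H, eW2sq μ ν ≠ ∞ := fun μ ν => (eW2sq_lt_top μ ν).ne
  have hmul : ∀ (c : NNReal) {e : ℝ≥0∞}, e ≠ ∞ → (c : ℝ≥0∞) * e ≠ ∞ :=
    fun c _ he => ENNReal.mul_ne_top ENNReal.coe_ne_top he
  have hbase' : W2 (γ t) ν₀ ^ 2 + a * b * A.toReal ≤
      a * W2 (γ 0) ν₀ ^ 2 + b * W2 (γ 1) ν₀ ^ 2 := by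
    have h := ENNReal.toReal_mono
      (ENNReal.add_ne_top.2 ⟨hmul _ (fin _ _), hmul _ (fin _ _)⟩) hbase
    rw [ENNReal.toReal_add (fin _ _) (hmul _ hAfin.ne),
      ENNReal.toReal_add (hmul _ (fin _ _)) (hmul _ (fin _ _))] at h
    simpa [W2_sq] using h
  have hfour' : ∀ ν, a * W2 (γ 0) ν ^ 2 + b * W2 (γ 1) ν ^ 2 ≤
      W2 (γ t) ν ^ 2 + a * b * A.toReal := fun ν => by
    have h := ENNReal.toReal_mono
      (ENNReal.add_ne_top.2 ⟨fin _ _, hmul _ hAfin.ne⟩) (hfour ν)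
    rw [ENNReal.toReal_add (fin _ _) (hmul _ hAfin.ne),
      ENNReal.toReal_add (hmul _ (fin _ _)) (hmul _ (fin _ _))] at h
    simpa [W2_sq] using h
  have hend' : W2 (γ 0) (γ 1) ^ 2 ≤ A.toReal := by
    rw [W2_sq]; exact ENNReal.toReal_mono hAfin.ne hend
  have hsum := integral_mono (((hint (γ 0)).const_mul (a : ℝ)).add ((hint (γ 1)).const_mul (b : ℝ)))
    ((hint (γ t)).add (integrable_const (a * b * A.toReal : ℝ))) hfour'
  rw [integral_add' ((hint (γ 0)).const_mul (a : ℝ)) ((hint (γ 1)).const_mul (b : ℝ)),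
    integral_add' (hint (γ t)) (integrable_const _), integral_const_mul, integral_const_mul,
    integral_const, measureReal_def, hσ, ENNReal.toReal_ofReal hα, smul_eq_mul] at hsum
  have hab0 : (0 : ℝ) ≤ a * b := by positivity
  -- The term (1 + α)abA from here against αabA in `hsum` leaves abA, bounded below by `h2`.
  have h1 := mul_le_mul_of_nonneg_left hbase' (by linarith : 0 ≤ 1 + α)
  have h2 := mul_le_mul_of_nonneg_left hend' hab0
  simp only [energy]
  linarith

end

end SignedBarycenter

theorem mainTheorem5 {H : Type*} [NormedAddCommGroup H] [InnerProductSpace ℝ H] [CompleteSpace H]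
    [TopologicalSpace.SeparableSpace H] [MeasurableSpace H] [BorelSpace H]
    (α : ℝ) (hα : 0 < α) (ν₀ : SignedBarycenter.P2 H) (σ : Measure (SignedBarycenter.P2 H))
    (hσ : σ Set.univ = ENNReal.ofReal α)
    (hσ₂ : ∫⁻ ν, SignedBarycenter.secondMoment ν ∂σ < ∞) :
    (∀ μ : SignedBarycenter.P2 H, Integrable (fun ν => SignedBarycenter.W2 μ ν ^ 2) σ) ∧
    SignedBarycenter.IsConvexAlong SignedBarycenter.W2
      {γ | SignedBarycenter.IsGeneralizedGeodesic ν₀ γ} 1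
      (SignedBarycenter.energy α ν₀ σ) := by
  have : SecondCountableTopology H := UniformSpace.secondCountable_of_separable H
  have : IsFiniteMeasure σ := ⟨by rw [hσ]; exact ENNReal.ofReal_lt_top⟩
  have hint := SignedBarycenter.integrable_W2_sq σ hσ₂
  exact ⟨hint, SignedBarycenter.isConvexAlong_energy hα.le ν₀ σ hσ hint⟩
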